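/- Let $M$ be a manifold without boundary, of class $C^3$ (in particular, possibly smooth) and of finite dimension $n \ge 2$; no Hausdorff, countability or connectedness assumption is needed. Let $g$ be a Lorentzian metric of class $C^2$ on $M$, i.e. a $C^2$ field of symmetric bilinear forms of signature $(-,+,\dots,+)$ on the tangent spaces of $M$, and let $(M,g)$ be time oriented by a continuous vector field $u$ with $g(u,u)<0$ everywhere. A tangent vector $v$ is *future pointing timelike* if $g(v,v)<0$ and $g(v,u)<0$, and a *future directed timelike path* is a $C^1$ map $\gamma:[0,1]\to M$ whose tangent vector $\gamma'(t)$ is future pointing timelike for every $t\in[0,1]$ (with one-sided derivatives at $t=0,1$). For $x\in M$ and $U\subseteq M$ let $I^+(x,U)$ be the set of all $y\in M$ for which there is a future directed timelike path $\gamma$ with $\gamma(0)=x$, $\gamma(1)=y$ and $\gamma([0,1])\subseteq U$; write $I^+(x)=I^+(x,M)$. Let $p,x,y\in M$ with $x\ne p$ and $y\ne p$. If $y\in I^+(x)$, then $y\in I^+(x,M\setminus\{p\})$. In other words, if two points different from $p$ are joined by a future directed timelike path, then they are joined by one that avoids $p$. -/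

import Mathlib

open Set Bundle Manifold
open scoped ContDiff Topology

noncomputable section

/-- A symmetric bilinear form on a finite-dimensional real vector space is Lorentzian if it has
signature `(-, +, ..., +)`. As the two indices of inertia add up to the dimension, the form is
nondegenerate. -/
structure IsLorentzianForm {V : Type*} [AddCommGroup V] [Module ℝ V]
    (B : LinearMap.BilinForm ℝ V) : Prop where
  symm : ∀ v w : V, B v w = B w v
  sigNeg_eq : sigNeg B.toQuadraticMap = 1
  sigPos_eq : sigPos B.toQuadraticMap + 1 = Module.finrank ℝ V

/-- A Lorentzian metric of class `C^k` on a manifold `M` without boundary modelled on `E`: a `C^k`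
field of bilinear forms on the tangent spaces, everywhere Lorentzian. -/
structure LorentzMetric (E : Type*) [NormedAddCommGroup E] [NormedSpace ℝ E] (k : ℕ∞ω)
    (M : Type*) [TopologicalSpace M] [ChartedSpace E M] [IsManifold 𝓘(ℝ, E) 1 M] where
  /-- The value of the metric at each point. -/
  form (x : M) : TangentSpace 𝓘(ℝ, E) x →L[ℝ] TangentSpace 𝓘(ℝ, E) x →L[ℝ] ℝ
  lorentzian (x : M) : IsLorentzianForm (form x).toLinearMap₁₂
  contMDiff : ContMDiff 𝓘(ℝ, E) (𝓘(ℝ, E).prod 𝓘(ℝ, E →L[ℝ] E →L[ℝ] ℝ)) k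
    (fun x : M ↦ TotalSpace.mk' (E →L[ℝ] E →L[ℝ] ℝ)
      (E := fun x : M ↦ TangentSpace 𝓘(ℝ, E) x →L[ℝ] TangentSpace 𝓘(ℝ, E) x →L[ℝ] ℝ) x (form x))

section Spacetime

variable {E : Type*} [NormedAddCommGroup E] [NormedSpace ℝ E] {k : ℕ∞ω}
  {M : Type*} [TopologicalSpace M] [ChartedSpace E M] [IsManifold 𝓘(ℝ, E) 1 M]

/-- A time orientation of a Lorentzian metric, given by a continuous vector field that is timelike
at every point. -/
structure TimeOrientation (g : LorentzMetric E k M) where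
  /-- The vector field that defines the time orientation. -/
  field (x : M) : TangentSpace 𝓘(ℝ, E) x
  continuous : Continuous (fun x : M ↦ (⟨x, field x⟩ : TangentBundle 𝓘(ℝ, E) M))
  timelike (x : M) : g.form x (field x) (field x) < 0

/-- A tangent vector `v` at `x` is future pointing timelike: it is timelike, `g(v, v) < 0`, and
`g(v, u) < 0` for the vector field `u` that defines the time orientation. -/
def IsFutureTimelike (g : LorentzMetric E k M) (u : TimeOrientation g) (x : M)
    (v : TangentSpace 𝓘(ℝ, E) x) : Prop :=
  g.form x v v < 0 ∧ g.form x v (u.field x) < 0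

/-- The tangent vector at the parameter `t` of a path `γ` defined on `[0, 1]` (one-sided at the
two end points). -/
def pathVelocity (E : Type*) [NormedAddCommGroup E] [NormedSpace ℝ E]
    {M : Type*} [TopologicalSpace M] [ChartedSpace E M] (γ : ℝ → M) (t : ℝ) :
    TangentSpace 𝓘(ℝ, E) (γ t) :=
  mfderivWithin 𝓘(ℝ, ℝ) 𝓘(ℝ, E) γ (Icc 0 1) t (1 : ℝ)

/-- `γ` restricted to `[0, 1]` is a future directed timelike path: it is of class `C^1` on `[0, 1]`
(end points included) and its tangent vector is future pointing timelike at every parameter.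
The values of `γ` outside `[0, 1]` play no role. -/
structure IsFutureTimelikePath (g : LorentzMetric E k M) (u : TimeOrientation g)
    (γ : ℝ → M) : Prop where
  contMDiffOn : ContMDiffOn 𝓘(ℝ, ℝ) 𝓘(ℝ, E) 1 γ (Icc 0 1)
  futureTimelike : ∀ t ∈ Icc (0 : ℝ) 1, IsFutureTimelike g u (γ t) (pathVelocity E γ t)

/-- The chronological future `I^+(x, U)` of `x` relative to `U`: the end points of the future
directed timelike paths that start at `x` and are totally contained in `U`. -/
def chronologicalFuture (g : LorentzMetric E k M) (u : TimeOrientation g) (x : M) (U : Set M) :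
    Set M :=
  {y | ∃ γ : ℝ → M, IsFutureTimelikePath g u γ ∧ γ 0 = x ∧ γ 1 = y ∧ ∀ t ∈ Icc (0 : ℝ) 1, γ t ∈ U}

end Spacetime

end

/-! Being future timelike is an open condition on a tangent vector, so it survives a `C^1`-small
perturbation of a path. Timelike vectors are nonzero, hence in a chart at `p` the path is locally
injective at each passage through `p`. Since the dimension is at least two, it can be pushed off `p`
there in a direction transverse to its velocity (`exists_perturbation_avoiding`), without creating
new passages (`exists_remove_parameter`). Passages are isolated, so by compactness there are
finitely many (`finite_setOf_eq`); removing them one at a time finishes the proof. -/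

/-- A `C^1` curve in a normed space of dimension at least two whose one-jets lie in an open set can
be modified near a parameter `t₀` with nonzero velocity, with its one-jets staying in that open set,
such that the modified part avoids the point `c t₀`. -/
theorem exists_perturbation_avoiding {E : Type*} [NormedAddCommGroup E] [NormedSpace ℝ E]
    [FiniteDimensional ℝ E] (hdim : 2 ≤ Module.finrank ℝ E) {O : Set (E × E)} (hO : IsOpen O)
    {c : ℝ → E} {a b t₀ : ℝ} (ht₀ : t₀ ∈ Ioo a b) (hc : ContDiffOn ℝ 1 c (Ioo a b))
    (hcO : ∀ t ∈ Ioo a b, (c t, deriv c t) ∈ O) (hv : deriv c t₀ ≠ 0) :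
    ∃ δ > 0, ∃ c' : ℝ → E, Icc (t₀ - δ) (t₀ + δ) ⊆ Ioo a b ∧ ContDiffOn ℝ 1 c' (Ioo a b) ∧
      (∀ t ∈ Ioo a b, (c' t, deriv c' t) ∈ O) ∧ (∀ t ∉ Icc (t₀ - δ) (t₀ + δ), c' t = c t) ∧
      ∀ t ∈ Icc (t₀ - δ) (t₀ + δ), c' t ≠ c t₀ := by
  -- The functional `l` is 1 on the velocity, so near `t₀` the value `l (c t)` differs from `l (c
  -- t₀)` for `t ≠ t₀`. Adding a multiple of `w ∈ ker l` keeps this, and at `t₀` itself it moves the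
  -- curve.
  obtain ⟨l, hl⟩ := SeparatingDual.exists_eq_one (R := ℝ) hv
  obtain ⟨w, hw, hlw⟩ : ∃ w : E, w ≠ 0 ∧ l w = 0 := by
    by_contra! h
    have hinj : Function.Injective l.toLinearMap :=
      (injective_iff_map_eq_zero _).2 fun z hz ↦ by
        by_contra hz'
        exact h z hz' hz
    have := LinearMap.finrank_le_finrank_of_injective hinj
    simp at this
    omega
  have hnhds : ∀ t ∈ Ioo a b, Ioo a b ∈ 𝓝 t := fun t ht ↦ isOpen_Ioo.mem_nhds ht
  have hdc : ∀ t ∈ Ioo a b, HasDerivAt c (deriv c t) t := fun t ht ↦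
    ((hc.differentiableOn one_ne_zero).differentiableAt (hnhds t ht)).hasDerivAt
  have hev : ∀ᶠ t in 𝓝 t₀, t ∈ Ioo a b ∧ (t ≠ t₀ → l (c t) ≠ l (c t₀)) := by
    have h1 : HasDerivAt (fun t ↦ l (c t)) (l (deriv c t₀)) t₀ :=
      l.hasFDerivAt.comp_hasDerivAt t₀ (hdc t₀ ht₀)
    have h2 := h1.eventually_ne (c := l (c t₀)) (by rw [hl]; exact one_ne_zero)
    rw [eventually_nhdsWithin_iff] at h2
    filter_upwards [h2, hnhds t₀ ht₀] with t h3 h4 using ⟨h4, h3⟩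
  obtain ⟨δ, hδ, hball⟩ := Metric.nhds_basis_closedBall.eventually_iff.1 hev
  rw [Real.closedBall_eq_Icc] at hball
  have hJ : Icc (t₀ - δ) (t₀ + δ) ⊆ Ioo a b := fun t ht ↦ (hball ht).1
  let φ : ContDiffBump t₀ := ⟨δ / 2, δ, by positivity, by linarith⟩
  have hφ : ContDiff ℝ 1 φ := φ.contDiff
  have hφ1 : φ t₀ = 1 := φ.one_of_mem_closedBall (Metric.mem_closedBall_self (by positivity))
  have hφs : tsupport φ = Icc (t₀ - δ) (t₀ + δ) := by
    rw [φ.tsupport_eq, Real.closedBall_eq_Icc]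
  have hφ0 : ∀ t ∉ Icc (t₀ - δ) (t₀ + δ), φ t = 0 := fun t ht ↦
    image_eq_zero_of_notMem_tsupport (hφs ▸ ht)
  have hφ0' : ∀ t ∉ Icc (t₀ - δ) (t₀ + δ), deriv φ t = 0 := fun t ht ↦
    image_eq_zero_of_notMem_tsupport fun h ↦ ht (hφs ▸ tsupport_deriv_subset h)
  have hder : ∀ ε : ℝ, ∀ t ∈ Ioo a b, HasDerivAt (fun s ↦ c s + (ε * φ s) • w)
      (deriv c t + (ε * deriv φ t) • w) t := fun ε t ht ↦
    (hdc t ht).add ((((hφ.differentiable one_ne_zero) t).hasDerivAt.const_mul ε).smul_const w)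
  -- The case `ε = 0` is the original curve; compactness of the bump's support makes the smallness
  -- of `ε` uniform in `t`.
  have htube : ∀ᶠ ε : ℝ in 𝓝 0, ∀ t ∈ Icc (t₀ - δ) (t₀ + δ),
      (c t + (ε * φ t) • w, deriv c t + (ε * deriv φ t) • w) ∈ O := by
    refine isCompact_Icc.eventually_forall_of_forall_eventually fun t ht ↦ ?_
    have hcont : ContinuousAt (fun z : ℝ × ℝ ↦
        (c z.2 + (z.1 * φ z.2) • w, deriv c z.2 + (z.1 * deriv φ z.2) • w)) (0, t) := by
      have h1 : ContinuousAt (fun z : ℝ × ℝ ↦ c z.2) (0, t) :=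
        (hdc t (hJ ht)).continuousAt.comp (x := ((0 : ℝ), t)) continuousAt_snd
      have h2 : ContinuousAt (fun z : ℝ × ℝ ↦ deriv c z.2) (0, t) :=
        ((hc.continuousOn_deriv_of_isOpen isOpen_Ioo le_rfl).continuousAt
          (hnhds t (hJ ht))).comp' (x := ((0 : ℝ), t)) continuousAt_snd
      have h3 : Continuous φ := hφ.continuous
      have h4 : Continuous (deriv φ) := hφ.continuous_deriv le_rfl
      exact (h1.add (by fun_prop)).prodMk (h2.add (by fun_prop))
    exact hcont.eventually_mem (hO.mem_nhds (by simpa using hcO t (hJ ht)))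
  obtain ⟨ε, hε, hε0⟩ := ((htube.filter_mono nhdsWithin_le_nhds).and
    (self_mem_nhdsWithin : {(0 : ℝ)}ᶜ ∈ 𝓝[≠] 0)).exists
  refine ⟨δ, hδ, fun s ↦ c s + (ε * φ s) • w, hJ, ?_, fun t ht ↦ ?_, fun t ht ↦ ?_, fun t ht h ↦ ?_⟩
  · exact hc.add ((contDiff_const.mul hφ).smul contDiff_const).contDiffOn
  · rw [(hder ε t ht).deriv]
    by_cases htJ : t ∈ Icc (t₀ - δ) (t₀ + δ)
    · exact hε t htJ
    · simpa [hφ0 t htJ, hφ0' t htJ] using hcO t ht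
  · simp [hφ0 t ht]
  · rcases eq_or_ne t t₀ with rfl | hne
    · simp only [hφ1, mul_one, add_eq_left, smul_eq_zero] at h
      exact h.elim hε0 hw
    · refine (hball ht).2 hne ?_
      simpa [hlw] using congrArg l h

section Spacetime

variable {E : Type*} [NormedAddCommGroup E] [NormedSpace ℝ E] {k : ℕ∞ω}
  {M : Type*} [TopologicalSpace M] [ChartedSpace E M] [IsManifold 𝓘(ℝ, E) 1 M]

/-- The future pointing timelike vectors form an open subset of the tangent bundle. -/
theorem isOpen_setOf_isFutureTimelike (g : LorentzMetric E k M) (u : TimeOrientation g) :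
    IsOpen {q : TangentBundle 𝓘(ℝ, E) M | IsFutureTimelike g u q.1 q.2} := by
  have hπ : Continuous (fun q : TangentBundle 𝓘(ℝ, E) M ↦ q.1) :=
    FiberBundle.continuous_proj E _
  have hg := g.contMDiff.continuous.comp hπ
  have hv : Continuous (fun q : TangentBundle 𝓘(ℝ, E) M ↦ TotalSpace.mk' E q.1 q.2) :=
    continuous_id
  have hu : Continuous
      (fun q : TangentBundle 𝓘(ℝ, E) M ↦ TotalSpace.mk' E q.1 (u.field q.1)) :=
    u.continuous.comp hπ
  have key : ∀ w : (q : TangentBundle 𝓘(ℝ, E) M) → TangentSpace 𝓘(ℝ, E) q.1,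
      Continuous (fun q : TangentBundle 𝓘(ℝ, E) M ↦ TotalSpace.mk' E q.1 (w q)) →
      Continuous (fun q : TangentBundle 𝓘(ℝ, E) M ↦ g.form q.1 q.2 (w q)) := by
    intro w hw
    have h : Continuous (fun q : TangentBundle 𝓘(ℝ, E) M ↦
        TotalSpace.mk' ℝ (E := Bundle.Trivial M ℝ) q.1 (g.form q.1 q.2 (w q))) :=
      Continuous.clm_bundle_apply₂ (F₁ := E) (F₂ := E) (F₃ := ℝ) hg hv hw
    exact ((Bundle.Trivial.homeomorphProd M ℝ).continuous.comp h).snd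
  exact (isOpen_lt (key _ hv) continuous_const).inter (isOpen_lt (key _ hu) continuous_const)

/-- The future pointing timelike vectors over the chart at `p`, in the coordinates of that chart. -/
def futureConeInChart (g : LorentzMetric E k M) (u : TimeOrientation g) (p : M) : Set (E × E) :=
  {z | z.1 ∈ (extChartAt 𝓘(ℝ, E) p).target ∧
    IsFutureTimelike g u ((extChartAt 𝓘(ℝ, E) p).symm z.1)
      (mfderiv 𝓘(ℝ, E) 𝓘(ℝ, E) (extChartAt 𝓘(ℝ, E) p).symm z.1 z.2)}

theorem isOpen_futureConeInChart (g : LorentzMetric E k M) (u : TimeOrientation g) (p : M) :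
    IsOpen (futureConeInChart g u p) := by
  have hT : IsOpen (extChartAt 𝓘(ℝ, E) p).target := isOpen_extChartAt_target p
  have h1 := (contMDiffOn_extChartAt_symm (I := 𝓘(ℝ, E)) (n := 1) p).continuousOn_tangentMapWithin
    le_rfl hT.uniqueMDiffOn
  have h2 : Continuous (fun z : E × E ↦ (⟨z.1, z.2⟩ : TangentBundle 𝓘(ℝ, E) E)) :=
    (tangentBundleModelSpaceHomeomorph 𝓘(ℝ, E)).symm.continuous
  have h3 := (h1.comp (s := (extChartAt 𝓘(ℝ, E) p).target ×ˢ univ) h2.continuousOn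
    (fun z hz ↦ hz.1)).isOpen_inter_preimage (hT.prod isOpen_univ)
    (isOpen_setOf_isFutureTimelike g u)
  convert h3 using 1
  ext z
  simp only [futureConeInChart, mem_ofPred_eq, mem_inter_iff, mem_prod, mem_univ, and_true,
    mem_preimage, Function.comp, tangentMapWithin]
  refine and_congr_right fun hz ↦ ?_
  rw [mfderivWithin_of_isOpen hT hz]

/-- At an interior parameter the derivative within `[0, 1]` is the ordinary one, and the chain rule
applies. -/
theorem isFutureTimelike_pathVelocity_iff (g : LorentzMetric E k M) (u : TimeOrientation g) (p : M)
    {c : ℝ → E} {t : ℝ} (ht : t ∈ Ioo (0 : ℝ) 1) (hc : DifferentiableAt ℝ c t)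
    (hct : c t ∈ (extChartAt 𝓘(ℝ, E) p).target) :
    IsFutureTimelike g u ((extChartAt 𝓘(ℝ, E) p).symm (c t))
      (pathVelocity E (fun s ↦ (extChartAt 𝓘(ℝ, E) p).symm (c s)) t) ↔
    (c t, deriv c t) ∈ futureConeInChart g u p := by
  have hT : IsOpen (extChartAt 𝓘(ℝ, E) p).target := isOpen_extChartAt_target p
  have hs : MDifferentiableAt 𝓘(ℝ, E) 𝓘(ℝ, E) (extChartAt 𝓘(ℝ, E) p).symm (c t) :=
    ((contMDiffOn_extChartAt_symm (I := 𝓘(ℝ, E)) (n := 1) p).contMDiffAt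
      (hT.mem_nhds hct)).mdifferentiableAt one_ne_zero
  have hv : pathVelocity E (fun s ↦ (extChartAt 𝓘(ℝ, E) p).symm (c s)) t =
      mfderiv 𝓘(ℝ, E) 𝓘(ℝ, E) (extChartAt 𝓘(ℝ, E) p).symm (c t) (deriv c t) := by
    have h := mfderiv_comp t hs hc.mdifferentiableAt
    rw [pathVelocity, mfderivWithin_of_mem_nhds (Icc_mem_nhds ht.1 ht.2)]
    change mfderiv 𝓘(ℝ, ℝ) 𝓘(ℝ, E) ((extChartAt 𝓘(ℝ, E) p).symm ∘ c) t (1 : ℝ) = _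
    rw [h, mfderiv_eq_fderiv]
    rfl
  rw [hv]
  exact ⟨fun h ↦ ⟨hct, h⟩, fun h ↦ h.2⟩

theorem isFutureTimelike_pathVelocity_congr (g : LorentzMetric E k M) (u : TimeOrientation g)
    {γ γ' : ℝ → M} {t : ℝ} (h : γ =ᶠ[𝓝 t] γ') :
    IsFutureTimelike g u (γ t) (pathVelocity E γ t) ↔
      IsFutureTimelike g u (γ' t) (pathVelocity E γ' t) := by
  have hv : (pathVelocity E γ t : E) = pathVelocity E γ' t := by
    rw [pathVelocity, pathVelocity,
      (h.filter_mono nhdsWithin_le_nhds).mfderivWithin_eq h.self_of_nhds]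
    rfl
  -- The velocities lie in tangent spaces at points that are only propositionally equal; viewing
  -- both as elements of `E` allows the substitution.
  have aux : ∀ (x x' : M) (v v' : E), x = x' → v = v' →
      (IsFutureTimelike g u x v ↔ IsFutureTimelike g u x' v') := by
    rintro x _ v _ rfl rfl
    rfl
  exact aux _ _ _ _ h.self_of_nhds hv

end Spacetime

section Spacetime

variable {E : Type*} [NormedAddCommGroup E] [NormedSpace ℝ E] {k : ℕ∞ω}
  {M : Type*} [TopologicalSpace M] [ChartedSpace E M] [IsManifold 𝓘(ℝ, E) 1 M]

/-- A future directed timelike path read in the chart at `p` is of class `C^1`, with velocities in the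
future cones. -/
theorem IsFutureTimelikePath.mem_futureConeInChart {g : LorentzMetric E k M}
    {u : TimeOrientation g} {γ : ℝ → M} (hγ : IsFutureTimelikePath g u γ) {p : M} {a b : ℝ}
    (hab : Ioo a b ⊆ Ioo 0 1) (hsource : ∀ t ∈ Ioo a b, γ t ∈ (extChartAt 𝓘(ℝ, E) p).source) :
    ContDiffOn ℝ 1 (fun t ↦ extChartAt 𝓘(ℝ, E) p (γ t)) (Ioo a b) ∧
    ∀ t ∈ Ioo a b, (extChartAt 𝓘(ℝ, E) p (γ t), deriv (fun t ↦ extChartAt 𝓘(ℝ, E) p (γ t)) t) ∈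
      futureConeInChart g u p := by
  have hc : ContDiffOn ℝ 1 (fun t ↦ extChartAt 𝓘(ℝ, E) p (γ t)) (Ioo a b) := by
    rw [← contMDiffOn_iff_contDiffOn]
    refine (contMDiffOn_extChartAt (I := 𝓘(ℝ, E)) (n := 1) (x := p)).comp
      (hγ.contMDiffOn.mono (hab.trans Ioo_subset_Icc_self)) fun t ht ↦ ?_
    rw [← extChartAt_source 𝓘(ℝ, E)]
    exact hsource t ht
  refine ⟨hc, fun t ht ↦ ?_⟩
  have hd := (hc.differentiableOn one_ne_zero).differentiableAt (isOpen_Ioo.mem_nhds ht)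
  have htarget := (extChartAt 𝓘(ℝ, E) p).map_source (hsource t ht)
  rw [← isFutureTimelike_pathVelocity_iff g u p (hab ht) hd htarget]
  refine (isFutureTimelike_pathVelocity_congr g u
    (γ' := fun s ↦ (extChartAt 𝓘(ℝ, E) p).symm (extChartAt 𝓘(ℝ, E) p (γ s))) ?_).1
    (hγ.futureTimelike t (Ioo_subset_Icc_self (hab ht)))
  filter_upwards [isOpen_Ioo.mem_nhds ht] with s hs
  exact ((extChartAt 𝓘(ℝ, E) p).left_inv (hsource s hs)).symm

theorem ne_zero_of_mem_futureConeInChart {g : LorentzMetric E k M} {u : TimeOrientation g} {p : M}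
    {z : E × E} (hz : z ∈ futureConeInChart g u p) : z.2 ≠ 0 := by
  intro h
  have hv : mfderiv 𝓘(ℝ, E) 𝓘(ℝ, E) (extChartAt 𝓘(ℝ, E) p).symm z.1 z.2 = 0 := by
    rw [h]
    exact map_zero (mfderiv 𝓘(ℝ, E) 𝓘(ℝ, E) (extChartAt 𝓘(ℝ, E) p).symm z.1)
  have h1 := hz.2.1
  rw [hv, map_zero] at h1
  exact lt_irrefl _ h1

/-- If a future directed timelike path meets `p` at an interior parameter `t₀`, then it can be
modified so that it does not meet `p` at `t₀` and meets `p` at no new parameter. -/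
theorem IsFutureTimelikePath.exists_remove_parameter [FiniteDimensional ℝ E]
    (hdim : 2 ≤ Module.finrank ℝ E) {g : LorentzMetric E k M} {u : TimeOrientation g} {γ : ℝ → M}
    (hγ : IsFutureTimelikePath g u γ) {p : M} {t₀ : ℝ} (ht₀ : t₀ ∈ Ioo (0 : ℝ) 1)
    (hp : γ t₀ = p) :
    ∃ γ' : ℝ → M, IsFutureTimelikePath g u γ' ∧ γ' 0 = γ 0 ∧ γ' 1 = γ 1 ∧ γ' t₀ ≠ p ∧
      ∀ t, γ' t = p → γ t = p := by
  set e := extChartAt 𝓘(ℝ, E) p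
  have hcont : ContinuousAt γ t₀ :=
    hγ.contMDiffOn.continuousOn.continuousAt (Icc_mem_nhds ht₀.1 ht₀.2)
  have hU : ∀ᶠ t in 𝓝 t₀, t ∈ Ioo (0 : ℝ) 1 ∧ γ t ∈ e.source :=
    Filter.Eventually.and (Ioo_mem_nhds ht₀.1 ht₀.2)
      (hcont.eventually_mem (by rw [hp]; exact extChartAt_source_mem_nhds p))
  obtain ⟨a, b, ht₀ab, hab⟩ := mem_nhds_iff_exists_Ioo_subset.1 hU
  have hab01 : Ioo a b ⊆ Ioo 0 1 := fun t ht ↦ (hab ht).1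
  have hsource : ∀ t ∈ Ioo a b, γ t ∈ e.source := fun t ht ↦ (hab ht).2
  obtain ⟨hc, hcone⟩ := hγ.mem_futureConeInChart hab01 hsource
  obtain ⟨δ, hδ, c, hJ, hcC, hcc, hcout, hcin⟩ := exists_perturbation_avoiding hdim
    (isOpen_futureConeInChart g u p) ht₀ab hc hcone
    (ne_zero_of_mem_futureConeInChart (hcone t₀ ht₀ab))
  set J := Icc (t₀ - δ) (t₀ + δ)
  classical
  -- Both formulas agree on `Ioo a b` outside the closed set `J`, so near every parameter `γ'` is
  -- given by a single one of them, including at the end points of `J`.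
  let γ' : ℝ → M := fun t ↦ if t ∈ J then e.symm (c t) else γ t
  have hin : ∀ t ∈ Ioo a b, γ' t = e.symm (c t) := by
    intro t ht
    by_cases htJ : t ∈ J
    · exact if_pos htJ
    · rw [hcout t htJ, e.left_inv (hsource t ht)]
      exact if_neg htJ
  have hout : ∀ t ∉ J, γ' t = γ t := fun t ht ↦ if_neg ht
  have hin' : ∀ t ∈ Ioo a b, γ' =ᶠ[𝓝 t] fun s ↦ e.symm (c s) := fun t ht ↦
    Filter.eventually_of_mem (isOpen_Ioo.mem_nhds ht) hin
  have hout' : ∀ t ∉ J, γ' =ᶠ[𝓝 t] γ := fun t ht ↦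
    Filter.eventually_of_mem (isClosed_Icc.isOpen_compl.mem_nhds ht) hout
  have hne : ∀ t ∈ J, γ' t ≠ p := by
    intro t ht h
    rw [hin t (hJ ht)] at h
    -- `futureConeInChart` includes membership in the chart target, so the perturbed curve stays in
    -- the chart.
    have hr : e (e.symm (c t)) = c t := e.right_inv (hcc t (hJ ht)).1
    refine hcin t ht ?_
    rw [hp, ← hr, h]
  have h01 : ∀ t ∈ J, t ∈ Ioo (0 : ℝ) 1 := fun t ht ↦ hab01 (hJ ht)
  refine ⟨γ', ⟨fun t ht ↦ ?_, fun t ht ↦ ?_⟩, hout 0 fun h ↦ lt_irrefl _ (h01 0 h).1,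
    hout 1 fun h ↦ lt_irrefl _ (h01 1 h).2, hne t₀ ⟨by linarith, by linarith⟩, fun t h ↦ ?_⟩
  · by_cases htJ : t ∈ J
    · have h1 : ContMDiffAt 𝓘(ℝ, ℝ) 𝓘(ℝ, E) 1 c t :=
        (hcC.contDiffAt (isOpen_Ioo.mem_nhds (hJ htJ))).contMDiffAt
      have h2 : ContMDiffAt 𝓘(ℝ, E) 𝓘(ℝ, E) 1 e.symm (c t) :=
        (contMDiffOn_extChartAt_symm (I := 𝓘(ℝ, E)) (n := 1) p).contMDiffAt
          ((isOpen_extChartAt_target p).mem_nhds (hcc t (hJ htJ)).1)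
      exact ((h2.comp t h1).congr_of_eventuallyEq (hin' t (hJ htJ))).contMDiffWithinAt
    · exact (hγ.contMDiffOn t ht).congr_of_eventuallyEq
        ((hout' t htJ).filter_mono nhdsWithin_le_nhds) (hout t htJ)
  · by_cases htJ : t ∈ J
    · have htab := hJ htJ
      rw [isFutureTimelike_pathVelocity_congr g u (hin' t htab),
        isFutureTimelike_pathVelocity_iff g u p (hab01 htab)
          ((hcC.differentiableOn one_ne_zero).differentiableAt (isOpen_Ioo.mem_nhds htab))
          (hcc t htab).1]
      exact hcc t htab
    · rw [isFutureTimelike_pathVelocity_congr g u (hout' t htJ)]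
      exact hγ.futureTimelike t ht
  · by_cases htJ : t ∈ J
    · exact absurd h (hne t htJ)
    · rwa [hout t htJ] at h

/-- A future directed timelike path whose end points differ from `p` meets `p` at finitely many
parameters only. -/
theorem IsFutureTimelikePath.finite_setOf_eq {g : LorentzMetric E k M} {u : TimeOrientation g}
    {γ : ℝ → M} (hγ : IsFutureTimelikePath g u γ) {p : M} (h0 : γ 0 ≠ p) (h1 : γ 1 ≠ p) :
    {t | t ∈ Icc (0 : ℝ) 1 ∧ γ t = p}.Finite := by
  -- Closedness of `{p}` is the only separation needed: it puts the accumulation parameter itself in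
  -- the preimage of `p`.
  have : T1Space M := ChartedSpace.t1Space E M
  by_contra hinf
  obtain ⟨t, ht, hacc⟩ := Set.Infinite.exists_accPt_of_subset_isCompact hinf isCompact_Icc
    fun t ht ↦ ht.1
  have hfreq := accPt_iff_frequently.1 hacc
  have hp : γ t = p := by
    by_contra hne
    have h2 := (hγ.contMDiffOn.continuousOn t ht).eventually_mem
      (isOpen_compl_singleton.mem_nhds hne)
    rw [eventually_nhdsWithin_iff] at h2
    obtain ⟨s, ⟨-, hs⟩, hs'⟩ := (hfreq.and_eventually h2).exists
    exact hs' hs.1 hs.2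
  have ht01 : t ∈ Ioo (0 : ℝ) 1 := by
    refine ⟨lt_of_le_of_ne ht.1 ?_, lt_of_le_of_ne ht.2 ?_⟩
    · rintro rfl
      exact h0 hp
    · rintro rfl
      exact h1 hp
  have hU : ∀ᶠ s in 𝓝 t, s ∈ Ioo (0 : ℝ) 1 ∧ γ s ∈ (extChartAt 𝓘(ℝ, E) p).source :=
    Filter.Eventually.and (Ioo_mem_nhds ht01.1 ht01.2)
      ((hγ.contMDiffOn.continuousOn.continuousAt (Icc_mem_nhds ht01.1 ht01.2)).eventually_mem
        (by rw [hp]; exact extChartAt_source_mem_nhds p))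
  obtain ⟨a, b, htab, hab⟩ := mem_nhds_iff_exists_Ioo_subset.1 hU
  obtain ⟨hc, hcone⟩ := hγ.mem_futureConeInChart (fun s hs ↦ (hab hs).1) fun s hs ↦ (hab hs).2
  -- A nonzero derivative in the chart isolates the parameter `t`, against its being an accumulation
  -- point.
  have h2 := ((hc.differentiableOn one_ne_zero).differentiableAt
    (isOpen_Ioo.mem_nhds htab)).hasDerivAt.eventually_ne (c := extChartAt 𝓘(ℝ, E) p p)
    (ne_zero_of_mem_futureConeInChart (hcone t htab))
  rw [eventually_nhdsWithin_iff] at h2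
  obtain ⟨s, ⟨hst, hs⟩, hs'⟩ := (hfreq.and_eventually h2).exists
  exact hs' hst (by rw [hs.2])

/-- A future directed timelike path whose end points differ from `p` can be modified so that it
avoids `p`. -/
theorem IsFutureTimelikePath.exists_avoiding [FiniteDimensional ℝ E]
    (hdim : 2 ≤ Module.finrank ℝ E) {g : LorentzMetric E k M} {u : TimeOrientation g} {γ : ℝ → M}
    (hγ : IsFutureTimelikePath g u γ) {p : M} (h0 : γ 0 ≠ p) (h1 : γ 1 ≠ p) :
    ∃ γ' : ℝ → M, IsFutureTimelikePath g u γ' ∧ γ' 0 = γ 0 ∧ γ' 1 = γ 1 ∧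
      ∀ t ∈ Icc (0 : ℝ) 1, γ' t ≠ p := by
  -- The induction is on the number of passages; finiteness is what makes `ncard` drop strictly.
  induction hn : {t | t ∈ Icc (0 : ℝ) 1 ∧ γ t = p}.ncard using Nat.strong_induction_on
    generalizing γ with
  | _ n ih =>
    by_cases h : ∀ t ∈ Icc (0 : ℝ) 1, γ t ≠ p
    · exact ⟨γ, hγ, rfl, rfl, h⟩
    push Not at h
    obtain ⟨t, ht, hp⟩ := h
    have ht01 : t ∈ Ioo (0 : ℝ) 1 := by
      refine ⟨lt_of_le_of_ne ht.1 ?_, lt_of_le_of_ne ht.2 ?_⟩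
      · rintro rfl
        exact h0 hp
      · rintro rfl
        exact h1 hp
    obtain ⟨γ₁, hγ₁, h10, h11, h1t, hsub⟩ := hγ.exists_remove_parameter hdim ht01 hp
    have hlt : {t | t ∈ Icc (0 : ℝ) 1 ∧ γ₁ t = p}.ncard < n := by
      rw [← hn]
      refine Set.ncard_lt_ncard ⟨fun s hs ↦ ⟨hs.1, hsub s hs.2⟩, fun h ↦ h1t ?_⟩
        (hγ.finite_setOf_eq h0 h1)
      exact (h ⟨ht, hp⟩).2
    obtain ⟨γ₂, hγ₂, h20, h21, h2⟩ := ih _ hlt hγ₁ (h10 ▸ h0) (h11 ▸ h1) rfl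
    exact ⟨γ₂, hγ₂, h20.trans h10, h21.trans h11, h2⟩

end Spacetime

theorem lemma2p3 {E : Type*} [NormedAddCommGroup E] [NormedSpace ℝ E] [FiniteDimensional ℝ E]
    (hdim : 2 ≤ Module.finrank ℝ E)
    {M : Type*} [TopologicalSpace M] [ChartedSpace E M] [IsManifold 𝓘(ℝ, E) 3 M]
    (g : LorentzMetric E 2 M) (u : TimeOrientation g)
    (p x y : M) (hx : x ≠ p) (hy : y ≠ p)
    (hxy : y ∈ chronologicalFuture g u x univ) :
    y ∈ chronologicalFuture g u x {p}ᶜ := by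
  obtain ⟨γ, hγ, rfl, rfl, -⟩ := hxy
  obtain ⟨γ', hγ', h0, h1, h⟩ := hγ.exists_avoiding hdim hx hy
  exact ⟨γ', hγ', h0, h1, h⟩
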